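/- Let $k$ be a commutative domain (for instance a field), let $n\ge 3$ be an odd integer, and suppose that the characteristic of $k$ does not divide $(n-1)!$ (this holds in particular in characteristic $0$). Let $\mathcal A=\{a_{ij}\in k \mid 1\le i<j\le n\}$ be any family of scalars, and let $V_n(\mathcal A)$ be the modified $(-1)$-quantum Weyl algebra, that is, the associative unital $k$-algebra generated by $x_1,\dots,x_n$ subject to the relations \[ x_ix_j+x_jx_i=a_{ij}\qquad (1\le i<j\le n). \] Then the group $\operatorname{Aut}(V_n(\mathcal A))$ of $k$-algebra automorphisms of $V_n(\mathcal A)$ contains a free group of rank two. As a consequence, it also contains a free group of countably infinite rank. -/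

import Mathlib

/-- The defining relations `xᵢ xⱼ + xⱼ xᵢ = aᵢⱼ`, one for each pair `i < j`, of the modified
`(-1)`-quantum Weyl algebra. Only the scalars `a i j` with `i < j` are used. -/
inductive ModifiedQuantumWeylRel {k : Type*} [CommRing k] {n : ℕ} (a : Fin n → Fin n → k) :
    FreeAlgebra k (Fin n) → FreeAlgebra k (Fin n) → Prop
  | anticomm (i j : Fin n) (hij : i < j) :
      ModifiedQuantumWeylRel a
        (FreeAlgebra.ι k i * FreeAlgebra.ι k j + FreeAlgebra.ι k j * FreeAlgebra.ι k i)
        (algebraMap k (FreeAlgebra k (Fin n)) (a i j))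

/-- The modified `(-1)`-quantum Weyl algebra `V_n(𝒜)` over `k`: the associative unital `k`-algebra
generated by `x₁, …, xₙ` subject to the relations `xᵢ xⱼ + xⱼ xᵢ = aᵢⱼ` for all `i < j`. -/
def ModifiedQuantumWeyl {k : Type*} [CommRing k] {n : ℕ} (a : Fin n → Fin n → k) : Type _ :=
  RingQuot (ModifiedQuantumWeylRel a)

noncomputable instance ModifiedQuantumWeyl.instRing {k : Type*} [CommRing k] {n : ℕ}
    (a : Fin n → Fin n → k) : Ring (ModifiedQuantumWeyl a) :=
  inferInstanceAs (Ring (RingQuot (ModifiedQuantumWeylRel a)))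

noncomputable instance ModifiedQuantumWeyl.instAlgebra {k : Type*} [CommRing k] {n : ℕ}
    (a : Fin n → Fin n → k) : Algebra k (ModifiedQuantumWeyl a) :=
  inferInstanceAs (Algebra k (RingQuot (ModifiedQuantumWeylRel a)))

/-! Write n = m + 2 with m odd, and let ζ be the graded product of the m generators x₂, x₃, …. Each
xⱼ² is central, and as m is odd ζ commutes with these m generators. Hence [ζ, x₁] anticommutes with
every generator except possibly x₀, and adding f(x₁²)[ζ, x₁] to x₀ preserves all relations; the same
holds with x₀ and x₁ exchanged. For each of the two directions these transvections are additive in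
f.

Freeness is detected on points with values in a Clifford algebra over F[X], where F is the fraction
field of k. At suitable points xₗ is sent to uₗ + αₗ gp + βₗ gm, where gp, gm are eigenvectors of ad
ζ with eigenvalues ±2^(m+1), and αₗ = βₗ = 0 for l ≥ 2. A transvection changes (α₀, β₀) by q ·
2^(m+1) · (α₁, -β₁), where q is f evaluated at x₁², a polynomial of positive degree when f is
nonconstant and the coordinates are large (`IsState.comp_transvectionHom`). So it makes x₀ dominate
x₁ in degree (`comp_transvectionHom_mem`), the opposite transvections do the reverse, and ping-pong
from a balanced point (`exists_balanced_state`) shows that the products of the two kinds are free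
generators. -/

/-! ### Ping-pong for free groups. -/

section PingPong

/-- A ping-pong criterion with a base point: no set `T l` contains the base point, and each letter
`l` sends the base point, and every `T l'` with `l'` not inverse to `l`, into `T l`. -/
theorem FreeGroup.lift_injective_of_basepoint {ι G α : Type*} [Group G] [MulAction G α]
    (u : ι → G) (T : ι × Bool → Set α) (s : α) (hs : ∀ l, s ∉ T l)
    (h0 : ∀ l : ι × Bool, cond l.2 (u l.1) (u l.1)⁻¹ • s ∈ T l)
    (h1 : ∀ l l' : ι × Bool, (l.1 = l'.1 → l.2 = l'.2) →
      ∀ x ∈ T l', cond l.2 (u l.1) (u l.1)⁻¹ • x ∈ T l) :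
    Function.Injective (FreeGroup.lift u) := by
  classical
  have key : ∀ (L : List (ι × Bool)) (l : ι × Bool), FreeGroup.IsReduced (l :: L) →
      FreeGroup.lift u (FreeGroup.mk (l :: L)) • s ∈ T l := by
    intro L
    induction L with
    | nil =>
      intro l _
      simpa [FreeGroup.lift_mk] using h0 l
    | cons l' L ih =>
      intro l hl
      rw [FreeGroup.isReduced_cons_cons] at hl
      have := h1 l l' hl.1 _ (ih l' hl.2)
      rwa [smul_smul, FreeGroup.lift_mk, ← List.prod_cons, ← List.map_cons
        (f := fun x : ι × Bool => cond x.2 (u x.1) (u x.1)⁻¹), ← FreeGroup.lift_mk] at this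
  rw [injective_iff_map_eq_one]
  intro w hw
  by_contra hne
  have hred := FreeGroup.isReduced_toWord (x := w)
  have hmk := FreeGroup.mk_toWord (x := w)
  cases hL : w.toWord with
  | nil => exact hne (FreeGroup.toWord_eq_nil_iff.1 hL)
  | cons l L =>
    rw [hL] at hred hmk
    have := key L l hred
    rw [hmk, hw, one_smul] at this
    exact hs l this

/-- If `Φ i` and `Ψ i` are such that the `Φ i`, their inverses and the quotients
`(Φ i)⁻¹ * Φ j` map `Z₂` into `Y₁`, and symmetrically for `Ψ`, then the products `Φ i * Ψ i` are
free generators. -/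
theorem FreeGroup.lift_mul_injective {ι G α : Type*} [Group G] [MulAction G α]
    (Φ Ψ : ι → G) (Y₁ Z₁ Y₂ Z₂ : Set α) (hY₁ : Y₁ ⊆ Z₁) (hY₂ : Y₂ ⊆ Z₂) (s : α)
    (hs₁ : s ∈ Z₁) (hs₂ : s ∈ Z₂) (hn₁ : s ∉ Y₁) (hn₂ : s ∉ Y₂)
    (hΦ : ∀ i, ∀ x ∈ Z₂, Φ i • x ∈ Y₁) (hΦ' : ∀ i, ∀ x ∈ Z₂, (Φ i)⁻¹ • x ∈ Y₁)
    (hΦΦ : ∀ i j, i ≠ j → ∀ x ∈ Z₂, (Φ i)⁻¹ • Φ j • x ∈ Y₁)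
    (hΨ : ∀ i, ∀ x ∈ Z₁, Ψ i • x ∈ Y₂) (hΨ' : ∀ i, ∀ x ∈ Z₁, (Ψ i)⁻¹ • x ∈ Y₂)
    (hΨΨ : ∀ i j, i ≠ j → ∀ x ∈ Z₁, Ψ i • (Ψ j)⁻¹ • x ∈ Y₂) :
    Function.Injective (FreeGroup.lift fun i => Φ i * Ψ i) := by
  -- `T l` records the last factor applied: `Φ i` for the letter `i`, `(Ψ i)⁻¹` for its inverse. In
  -- a reduced word, two factors of the same kind meet only as `(Φ i)⁻¹ * Φ j` or `Ψ i * (Ψ j)⁻¹`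
  -- with `i ≠ j`.
  let T : ι × Bool → Set α := fun l =>
    cond l.2 ((fun x => Φ l.1 • x) '' Y₂) ((fun x => (Ψ l.1)⁻¹ • x) '' Y₁)
  refine FreeGroup.lift_injective_of_basepoint _ T s ?_ ?_ ?_
  · rintro ⟨i, _ | _⟩ ⟨x, hx, rfl⟩
    · exact hn₂ (hΨ' i x (hY₁ hx))
    · exact hn₁ (hΦ i x (hY₂ hx))
  · rintro ⟨i, _ | _⟩
    · exact ⟨(Φ i)⁻¹ • s, hΦ' i s hs₂, by simp [mul_smul]⟩
    · exact ⟨Ψ i • s, hΨ i s hs₁, by simp [mul_smul]⟩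
  · rintro ⟨i, _ | _⟩ ⟨j, _ | _⟩ hij y ⟨x, hx, rfl⟩
    · exact ⟨(Φ i)⁻¹ • (Ψ j)⁻¹ • x, hΦ' i _ (hY₂ (hΨ' j _ (hY₁ hx))), by simp [mul_smul]⟩
    · have hne : i ≠ j := fun h => by simpa using hij h
      exact ⟨(Φ i)⁻¹ • Φ j • x, hΦΦ i j hne _ (hY₂ hx), by simp [mul_smul]⟩
    · have hne : i ≠ j := fun h => by simpa using hij h
      exact ⟨Ψ i • (Ψ j)⁻¹ • x, hΨΨ i j hne _ (hY₁ hx), by simp [mul_smul]⟩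
    · exact ⟨Ψ i • Φ j • x, hΨ i _ (hY₁ (hΦ j _ (hY₂ hx))), by simp [mul_smul]⟩

end PingPong

/-! ### Graded products of elements with central anticommutators. -/

section AlternatingProduct

variable {A : Type*} [Ring A]

/-- The iterated graded commutator of the first `l` terms of a sequence; for a sequence of
generators of a Clifford algebra this is, up to a factor, their exterior product. -/
def gradedProd (y : ℕ → A) : ℕ → A
  | 0 => 1
  | l + 1 => gradedProd y l * y l + (-1) ^ l * (y l * gradedProd y l)

theorem gradedProd_congr {y z : ℕ → A} {l : ℕ} (h : ∀ i < l, y i = z i) :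
    gradedProd y l = gradedProd z l := by
  induction l with
  | zero => rfl
  | succ l ih =>
    simp only [gradedProd, h l l.lt_succ_self, ih fun i hi => h i (hi.trans l.lt_succ_self)]

theorem map_gradedProd {B F : Type*} [Ring B] [FunLike F A B] [RingHomClass F A B] (f : F)
    (y : ℕ → A) (l : ℕ) : f (gradedProd y l) = gradedProd (fun i => f (y i)) l := by
  induction l with
  | zero => simp [gradedProd]
  | succ l ih => simp [gradedProd, ih]

theorem commute_gradedProd {y : ℕ → A} {l : ℕ} {z : A} (h : ∀ i < l, Commute z (y i)) :
    Commute z (gradedProd y l) := by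
  induction l with
  | zero => exact Commute.one_right z
  | succ l ih =>
    have h1 := ih fun i hi => h i (hi.trans l.lt_succ_self)
    have h2 := h l l.lt_succ_self
    have h3 : Commute z ((-1) ^ l : A) := ((Commute.one_right z).neg_right).pow_right l
    exact (h1.mul_right h2).add_right (h3.mul_right (h2.mul_right h1))

/-- The commutator [y², x] equals [y, xy + yx]. -/
theorem sq_commute_of_anticomm_central {x y : A} (h : x * y + y * x ∈ Subring.center A) :
    Commute (y * y) x := by
  have h1 := Subring.mem_center_iff.1 h y
  rw [commute_iff_eq]
  have : y * y * x - x * (y * y) = y * (x * y + y * x) - (x * y + y * x) * y := by noncomm_ring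
  rw [← sub_eq_zero, this, h1, sub_self]

/-- The graded product of `l` elements with central anticommutators commutes (`l` odd) or
anticommutes (`l` even, positive) with each of them. -/
theorem gradedProd_mul_add {y : ℕ → A} {l : ℕ}
    (hy : ∀ i < l, ∀ j < l, i ≠ j → y i * y j + y j * y i ∈ Subring.center A) :
    ∀ i < l, gradedProd y l * y i + (-1) ^ l * (y i * gradedProd y l) = 0 := by
  induction l with
  | zero => intro i hi; omega
  | succ l ih =>
    intro i hi
    have ih' := ih fun i hi j hj => hy i (by omega) j (by omega)
    have hs : ((-1) ^ l : A) = 1 ∨ ((-1) ^ l : A) = -1 := neg_one_pow_eq_or A l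
    rw [gradedProd, pow_succ]
    -- For an earlier index, the inductive relation and the centrality of one anticommutator
    -- suffice. For the last one, everything cancels except the commutator of the shorter product
    -- with `y i * y i`.
    rcases Nat.lt_succ_iff_lt_or_eq.1 hi with h | rfl
    · have h1 := ih' i h
      have hc := Subring.mem_center_iff.1
        (hy i (by omega) l (by omega) (by omega)) (gradedProd y l)
      generalize gradedProd y l = w at *
      rcases hs with hs | hs <;> rw [hs] at h1 ⊢
      · have e : (w * y l + 1 * (y l * w)) * y i + 1 * -1 * (y i * (w * y l + 1 * (y l * w))) =
          (w * (y i * y l + y l * y i) - (y i * y l + y l * y i) * w)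
            + y l * (w * y i + 1 * (y i * w)) - (w * y i + 1 * (y i * w)) * y l := by
          noncomm_ring
        rw [e, hc, h1]; simp
      · have e : (w * y l + -1 * (y l * w)) * y i + -1 * -1 * (y i * (w * y l + -1 * (y l * w))) =
          (w * (y i * y l + y l * y i) - (y i * y l + y l * y i) * w)
            - y l * (w * y i + -1 * (y i * w)) - (w * y i + -1 * (y i * w)) * y l := by
          noncomm_ring
        rw [e, hc, h1]; simp
    · have hc : Commute (y i * y i) (gradedProd y i) := commute_gradedProd fun j hj =>
        sq_commute_of_anticomm_central (hy j (by omega) i (by omega) (by omega))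
      rw [commute_iff_eq] at hc
      generalize gradedProd y i = w at *
      rcases hs with hs | hs <;> rw [hs]
      · have e : (w * y i + 1 * (y i * w)) * y i + 1 * -1 * (y i * (w * y i + 1 * (y i * w))) =
          w * (y i * y i) - y i * y i * w := by noncomm_ring
        rw [e, hc, sub_self]
      · have e : (w * y i + -1 * (y i * w)) * y i + -1 * -1 * (y i * (w * y i + -1 * (y i * w))) =
          w * (y i * y i) - y i * y i * w := by noncomm_ring
        rw [e, hc, sub_self]

theorem gradedProd_commute {y : ℕ → A} {l : ℕ} (hl : Odd l)
    (hy : ∀ i < l, ∀ j < l, i ≠ j → y i * y j + y j * y i ∈ Subring.center A) {i : ℕ}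
    (hi : i < l) : Commute (gradedProd y l) (y i) := by
  have := gradedProd_mul_add hy i hi
  rw [hl.neg_one_pow] at this
  rw [commute_iff_eq, ← sub_eq_zero, ← this]
  noncomm_ring

end AlternatingProduct

/-! ### Clifford sequences and vectors with prescribed anticommutators. -/

section Clifford

variable {K R : Type*} [CommRing K] [Ring R] [Algebra K R]

/-- An infinite sequence of pairwise anticommuting elements with squares `1, -1, 1, -1, …`. -/
structure IsCliffordSequence (e : ℕ → R) : Prop where
  anticomm : ∀ i j, i ≠ j → e i * e j + e j * e i = 0
  sq : ∀ i, e i * e i = (-1) ^ i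

variable (K) in
/-- The span of the first `l` terms of a sequence. -/
def initialSpan (e : ℕ → R) (l : ℕ) : Submodule K R := Submodule.span K (e '' Set.Iio l)

theorem mem_initialSpan {e : ℕ → R} {i l : ℕ} (h : i < l) : e i ∈ initialSpan K e l :=
  Submodule.subset_span ⟨i, h, rfl⟩

theorem initialSpan_mono {e : ℕ → R} {l l' : ℕ} (h : l ≤ l') :
    initialSpan K e l ≤ initialSpan K e l' :=
  Submodule.span_mono (Set.image_mono fun _ hi => lt_of_lt_of_le hi h)

namespace IsCliffordSequence

variable {e : ℕ → R}

theorem add_mul_self (h : IsCliffordSequence e) (i : ℕ) :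
    e i * e i + e i * e i = algebraMap K R (2 * (-1) ^ i) := by
  rw [h.sq]; simp [two_mul]

theorem anticomm_of_mem (h : IsCliffordSequence e) {x : R} {l j : ℕ}
    (hx : x ∈ initialSpan K e l) (hj : l ≤ j) : x * e j + e j * x = 0 := by
  induction hx using Submodule.span_induction with
  | mem x hx =>
    obtain ⟨i, hi, rfl⟩ := hx
    exact h.anticomm i j (by have : i < l := hi; omega)
  | zero => simp
  | add x y _ _ hx hy =>
    rw [add_mul, mul_add, add_add_add_comm, hx, hy, add_zero]
  | smul c x _ hx =>
    rw [smul_mul_assoc, mul_smul_comm, ← smul_add, hx, smul_zero]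

theorem exists_anticommutator (h : IsCliffordSequence e) {x y : R} {l : ℕ}
    (hx : x ∈ initialSpan K e l) (hy : y ∈ initialSpan K e l) :
    ∃ c : K, x * y + y * x = algebraMap K R c := by
  induction hx using Submodule.span_induction with
  | mem x hx =>
    obtain ⟨i, hi, rfl⟩ := hx
    induction hy using Submodule.span_induction with
    | mem y hy =>
      obtain ⟨j, hj, rfl⟩ := hy
      by_cases hij : i = j
      · subst hij
        exact ⟨_, h.add_mul_self i⟩
      · exact ⟨0, by rw [h.anticomm i j hij, map_zero]⟩
    | zero => exact ⟨0, by simp⟩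
    | add x y _ _ hx hy =>
      obtain ⟨c, hc⟩ := hx
      obtain ⟨d, hd⟩ := hy
      exact ⟨c + d, by rw [add_mul, mul_add, add_add_add_comm, hc, hd, map_add]⟩
    | smul r x _ hx =>
      obtain ⟨c, hc⟩ := hx
      exact ⟨r * c, by
        rw [smul_mul_assoc, mul_smul_comm, ← smul_add, hc, map_mul, Algebra.smul_def]⟩
  | zero => exact ⟨0, by simp⟩
  | add x y _ _ hx hy =>
    obtain ⟨c, hc⟩ := hx
    obtain ⟨d, hd⟩ := hy
    exact ⟨c + d, by rw [add_mul, mul_add, add_add_add_comm, hc, hd, map_add]⟩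
  | smul r x _ hx =>
    obtain ⟨c, hc⟩ := hx
    exact ⟨r * c, by
      rw [smul_mul_assoc, mul_smul_comm, ← smul_add, hc, map_mul, Algebra.smul_def]⟩

theorem exists_sq [Invertible (2 : K)] (h : IsCliffordSequence e) {x : R} {l : ℕ}
    (hx : x ∈ initialSpan K e l) : ∃ c : K, x * x = algebraMap K R c := by
  obtain ⟨c, hc⟩ := h.exists_anticommutator hx hx
  refine ⟨⅟2 * c, ?_⟩
  rw [map_mul, ← hc, ← two_mul, ← mul_assoc, ← map_ofNat (algebraMap K R) 2, ← map_mul,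
    invOf_mul_self, map_one, one_mul]

/-- A vector in the span of the first `l` terms is determined, and can be prescribed, by its
anticommutators with a unitriangular system of vectors. -/
theorem exists_mem_anticommutator [Invertible (2 : K)] (h : IsCliffordSequence e) {v : ℕ → R}
    (b : ℕ → K) {l : ℕ} (hv : ∀ j < l, v j - e j ∈ initialSpan K e j) :
    ∃ u ∈ initialSpan K e l, ∀ j < l, u * v j + v j * u = algebraMap K R (b j) := by
  induction l with
  | zero => exact ⟨0, Submodule.zero_mem _, fun j hj => by omega⟩
  | succ l ih =>
    obtain ⟨u, hu, huv⟩ := ih fun j hj => hv j (by omega)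
    have hmem : ∀ j < l + 1, v j ∈ initialSpan K e (l + 1) := fun j hj => by
      have := Submodule.add_mem _ (initialSpan_mono (by omega) (hv j hj))
        (mem_initialSpan (K := K) (e := e) hj)
      rwa [sub_add_cancel] at this
    have hu' : u ∈ initialSpan K e (l + 1) := initialSpan_mono (Nat.le_succ l) hu
    obtain ⟨c, hc⟩ := h.exists_anticommutator hu' (hmem l l.lt_succ_self)
    -- Adding a multiple of `e l` leaves the earlier conditions intact, since `e l` anticommutes
    -- with the earlier `v j`. Its anticommutator with `v l` is that with `e l`, namely 2(-1)^l,
    -- whence the coefficient.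
    refine ⟨u + (⅟2 * (-1) ^ l * (b l - c)) • e l, Submodule.add_mem _ hu'
      (Submodule.smul_mem _ _ (mem_initialSpan l.lt_succ_self)), fun j hj => ?_⟩
    generalize hr : ⅟2 * (-1) ^ l * (b l - c) = r
    have e1 : (u + r • e l) * v j + v j * (u + r • e l) =
        (u * v j + v j * u) + r • (v j * e l + e l * v j) := by
      rw [add_mul, mul_add, smul_mul_assoc, mul_smul_comm, smul_add]; abel
    rw [e1]
    rcases Nat.lt_succ_iff_lt_or_eq.1 hj with hjl | rfl
    · have : v j ∈ initialSpan K e l := by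
        have := Submodule.add_mem _ (initialSpan_mono hjl.le (hv j hj))
          (mem_initialSpan (K := K) (e := e) hjl)
        rwa [sub_add_cancel] at this
      rw [huv j hjl, h.anticomm_of_mem this le_rfl, smul_zero, add_zero]
    · have e2 : v j * e j + e j * v j =
          ((v j - e j) * e j + e j * (v j - e j)) + (e j * e j + e j * e j) := by noncomm_ring
      rw [hc, e2, h.anticomm_of_mem (hv j hj) le_rfl, zero_add, h.add_mul_self (K := K),
        Algebra.smul_def, ← map_mul, ← map_add, ← hr]
      congr 1
      have h2 : ((-1) ^ j * (-1) ^ j : K) = 1 := by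
        rw [← mul_pow]; simp
      linear_combination (b j - c) * (-1) ^ j * (-1) ^ j * invOf_mul_self (2 : K) +
        (b j - c) * h2

/-- Unitriangular vectors with prescribed anticommutators. -/
theorem exists_unitriangular [Invertible (2 : K)] (h : IsCliffordSequence e) (b : ℕ → ℕ → K)
    (l : ℕ) : ∃ v : ℕ → R, (∀ j < l, v j - e j ∈ initialSpan K e j) ∧
      ∀ i j, i < j → j < l → v i * v j + v j * v i = algebraMap K R (b i j) := by
  induction l with
  | zero => exact ⟨e, by simp, by simp⟩
  | succ l ih =>
    obtain ⟨v, hv, hvv⟩ := ih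
    obtain ⟨u, hu, huv⟩ := h.exists_mem_anticommutator (fun i => b i l) hv
    refine ⟨Function.update v l (e l + u), fun j hj => ?_, fun i j hij hj => ?_⟩
    · rcases Nat.lt_succ_iff_lt_or_eq.1 hj with hjl | rfl
      · rw [Function.update_of_ne (by omega)]
        exact hv j hjl
      · rwa [Function.update_self, add_sub_cancel_left]
    · rw [Function.update_of_ne (by omega : i ≠ l)]
      rcases Nat.lt_succ_iff_lt_or_eq.1 hj with hjl | rfl
      · rw [Function.update_of_ne (by omega)]
        exact hvv i j hij hjl
      · have hvi : v i ∈ initialSpan K e j := by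
          have := Submodule.add_mem _ (initialSpan_mono hij.le (hv i hij))
            (mem_initialSpan (K := K) (e := e) hij)
          rwa [sub_add_cancel] at this
        have := h.anticomm_of_mem hvi le_rfl
        rw [Function.update_self, ← huv i hij, mul_add, add_mul, add_add_add_comm, this, zero_add,
          add_comm]

theorem mul_gradedProd (h : IsCliffordSequence e) {l j : ℕ} (hj : l ≤ j) :
    e j * gradedProd e l = (-1) ^ l * (gradedProd e l * e j) := by
  induction l with
  | zero => simp [gradedProd]
  | succ l ih =>
    have h1 := ih (by omega)
    have h2 := eq_neg_of_add_eq_zero_left (h.anticomm j l (by omega))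
    rw [gradedProd, pow_succ]
    generalize gradedProd e l = w at *
    rcases neg_one_pow_eq_or R l with hs | hs <;> rw [hs] at h1 ⊢
    · have h1' : e j * w = w * e j := by simpa using h1
      have e1 : e j * (w * e l + 1 * (e l * w)) = (e j * w) * e l + (e j * e l) * w := by
        noncomm_ring
      have e2 : w * e j * e l = w * (e j * e l) := by noncomm_ring
      have e3 : -(e l * e j) * w = - (e l * (e j * w)) := by noncomm_ring
      rw [e1, h1', e2, h2, e3, h1']; noncomm_ring
    · have h1' : e j * w = -(w * e j) := by simpa using h1
      have e1 : e j * (w * e l + -1 * (e l * w)) = (e j * w) * e l - (e j * e l) * w := by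
        noncomm_ring
      have e2 : -(w * e j) * e l = -(w * (e j * e l)) := by noncomm_ring
      have e3 : -(e l * e j) * w = - (e l * (e j * w)) := by noncomm_ring
      rw [e1, h1', e2, h2, e3, h1']; noncomm_ring

theorem gradedProd_succ (h : IsCliffordSequence e) (l : ℕ) :
    gradedProd e (l + 1) = 2 * (gradedProd e l * e l) := by
  rw [gradedProd, h.mul_gradedProd le_rfl, ← mul_assoc, ← pow_add,
    Even.neg_one_pow ⟨l, rfl⟩, one_mul, two_mul]

/-- The alternating squares are chosen for this: the sign (-1)^l from moving `e l` past the product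
cancels `e l * e l`. The result is the square of the scalar 2^l, so no root of -1 has to be
adjoined. -/
theorem gradedProd_sq (h : IsCliffordSequence e) (l : ℕ) :
    gradedProd e l * gradedProd e l = 4 ^ l := by
  induction l with
  | zero => simp [gradedProd]
  | succ l ih =>
    rw [h.gradedProd_succ]
    have h1 := h.mul_gradedProd (le_refl l)
    have h2 := h.sq l
    generalize gradedProd e l = w at *
    have e1 : 2 * (w * e l) * (2 * (w * e l)) = 4 * (w * (e l * w) * e l) := by noncomm_ring
    have hs : ((-1) ^ l * (-1) ^ l : R) = 1 := by
      rw [← pow_add, Even.neg_one_pow ⟨l, rfl⟩]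
    have hc : Commute ((-1) ^ l : R) (w * w) :=
      ((Commute.one_left _).neg_left).pow_left _
    have hcw : Commute ((-1) ^ l : R) w :=
      ((Commute.one_left _).neg_left).pow_left _
    have e2 : w * (e l * w) * e l = 4 ^ l := by
      rw [h1, ← mul_assoc w, hcw.symm.eq]
      have : (-1) ^ l * w * (w * e l) * e l = (-1) ^ l * (w * w) * (e l * e l) := by noncomm_ring
      rw [this, h2, hc.eq, mul_assoc, hs, mul_one, ih]
    rw [e1, e2, pow_succ']

theorem anticomm_mem_center (h : IsCliffordSequence e) (i j : ℕ) (hij : i ≠ j) :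
    e i * e j + e j * e i ∈ Subring.center R := by
  rw [h.anticomm i j hij]; exact Subring.zero_mem _

theorem gradedProd_mul_add_of_mem (h : IsCliffordSequence e) {l : ℕ} {x : R}
    (hx : x ∈ initialSpan K e l) :
    gradedProd e l * x + (-1) ^ l * (x * gradedProd e l) = 0 := by
  induction hx using Submodule.span_induction with
  | mem x hx =>
    obtain ⟨i, hi, rfl⟩ := hx
    exact gradedProd_mul_add (fun i _ j _ hij => h.anticomm_mem_center i j hij) i hi
  | zero => simp
  | add x y _ _ hx hy =>
    rw [add_mul, mul_add, mul_add, add_add_add_comm, hx, hy, add_zero]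
  | smul c x _ hx =>
    rw [smul_mul_assoc, mul_smul_comm, mul_smul_comm, ← smul_add, hx, smul_zero]

/-- Like an exterior product, the graded product ignores corrections in the span of earlier vectors:
their graded commutator with the product so far vanishes. -/
theorem gradedProd_unitriangular (h : IsCliffordSequence e) {v : ℕ → R} {l : ℕ}
    (hv : ∀ j < l, v j - e j ∈ initialSpan K e j) : gradedProd v l = gradedProd e l := by
  induction l with
  | zero => rfl
  | succ l ih =>
    have h1 := h.gradedProd_mul_add_of_mem (hv l l.lt_succ_self)
    rw [gradedProd, gradedProd, ih fun j hj => hv j (by omega), ← sub_eq_zero, ← h1, mul_sub,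
      sub_mul, mul_sub]
    abel

end IsCliffordSequence

universe u in
theorem exists_isCliffordSequence (K : Type u) [CommRing K] [Nontrivial K] [Invertible (2 : K)] :
    ∃ (R : Type u) (_ : Ring R) (_ : Algebra K R) (e : ℕ → R), IsCliffordSequence e ∧
      Function.Injective (algebraMap K R) := by
  classical
  -- The diagonal form with entries 1, -1, 1, -1, ….
  let B : (ℕ →₀ K) →ₗ[K] (ℕ →₀ K) →ₗ[K] K :=
    Finsupp.linearCombination K fun i => ((-1) ^ i : K) • Finsupp.lapply i
  have hB : ∀ i j, B (Finsupp.single i 1) (Finsupp.single j 1) = if i = j then (-1) ^ i else 0 := by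
    intro i j
    simp [B, Finsupp.single_apply, eq_comm]
  let Q : QuadraticForm K (ℕ →₀ K) := LinearMap.BilinMap.toQuadraticMap B
  refine ⟨CliffordAlgebra Q, inferInstance, inferInstance,
    fun i => CliffordAlgebra.ι Q (Finsupp.single i 1), ⟨fun i j hij => ?_, fun i => ?_⟩, ?_⟩
  · rw [CliffordAlgebra.ι_mul_ι_add_swap, LinearMap.BilinMap.polar_toQuadraticMap, hB, hB]
    simp [hij, hij.symm]
  · rw [CliffordAlgebra.ι_sq_scalar, LinearMap.BilinMap.toQuadraticMap_apply, hB]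
    simp
  -- With 2 invertible, the Clifford algebra is linearly isomorphic to the exterior algebra, whose
  -- scalars embed.
  · intro x y hxy
    have := congrArg (CliffordAlgebra.equivExterior Q) hxy
    simpa [CliffordAlgebra.equivExterior] using this

end Clifford

/-! ### The hyperbolic pair of eigenvectors. -/

section CliffordPoint

/-- The generators of index at least two, as a sequence. -/
def tailSeq {A : Type*} [Zero A] {m : ℕ} (x : Fin (m + 2) → A) (i : ℕ) : A :=
  if h : i < m then x ⟨i + 2, by omega⟩ else 0

theorem tailSeq_of_lt {A : Type*} [Zero A] {m : ℕ} (x : Fin (m + 2) → A) {i : ℕ} (h : i < m) :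
    tailSeq x i = x ⟨i + 2, by omega⟩ := dif_pos h

/-- A family of vectors `u` with prescribed anticommutators (except that of `u 0` and `u 1`),
together with a hyperbolic pair orthogonal to all of them, whose members are eigenvectors for the
commutator with the graded product of the `u i`, `2 ≤ i`. -/
structure CliffordPoint (K R : Type*) [CommRing K] [Ring R] [Algebra K R] {m : ℕ}
    (a : Fin (m + 2) → Fin (m + 2) → K) where
  gp : R
  gm : R
  u : Fin (m + 2) → R
  gp_sq : gp * gp = 0
  gm_sq : gm * gm = 0
  gp_gm : gp * gm + gm * gp = algebraMap K R (-4 ^ (m + 1))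
  comm_gp : gradedProd (tailSeq u) m * gp - gp * gradedProd (tailSeq u) m = (2 ^ (m + 1) : K) • gp
  comm_gm : gradedProd (tailSeq u) m * gm - gm * gradedProd (tailSeq u) m =
    -((2 ^ (m + 1) : K) • gm)
  gp_u : ∀ i, gp * u i + u i * gp = 0
  gm_u : ∀ i, gm * u i + u i * gm = 0
  comm_u : ∀ i, gradedProd (tailSeq u) m * u i = u i * gradedProd (tailSeq u) m
  u_sq : ∀ i, ∃ d, u i * u i = algebraMap K R d
  u_u : ∀ i j : Fin (m + 2), i < j → 2 ≤ (j : ℕ) → u i * u j + u j * u i = algebraMap K R (a i j)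
  u_u' : ∃ d, u 0 * u 1 + u 1 * u 0 = algebraMap K R d

/-- All `u i` are taken in the span of e₀, …, e₍ₘ₋₁₎, with the tail unitriangular, so that its
graded product η equals that of the `e i`. As m is odd, η commutes with this span and anticommutes
with E = eₘ, while η² = 4^m and E² = -1. -/
theorem IsCliffordSequence.nonempty_cliffordPoint {K R : Type*} [CommRing K] [Ring R]
    [Algebra K R] [Invertible (2 : K)] {e : ℕ → R} (he : IsCliffordSequence e) {m : ℕ}
    (hm : Odd m) (a : Fin (m + 2) → Fin (m + 2) → K) : Nonempty (CliffordPoint K R a) := by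
  obtain ⟨v, hv, hvv⟩ := he.exists_unitriangular
    (fun i j => if h : i < m ∧ j < m then a ⟨i + 2, by omega⟩ ⟨j + 2, by omega⟩ else 0) m
  have hw := fun p : Fin (m + 2) => he.exists_mem_anticommutator
    (fun j => if h : j < m then a p ⟨j + 2, by omega⟩ else 0) hv
  choose w hwm hw using hw
  have hvm : ∀ j < m, v j ∈ initialSpan K e m := fun j hj => by
    have := Submodule.add_mem _ (initialSpan_mono hj.le (hv j hj))
      (mem_initialSpan (K := K) (e := e) hj)
    rwa [sub_add_cancel] at this
  let u : Fin (m + 2) → R := fun i => if 2 ≤ (i : ℕ) then v (i - 2) else w i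
  have hum : ∀ i, u i ∈ initialSpan K e m := fun i => by
    by_cases h : 2 ≤ (i : ℕ)
    · simpa only [u, if_pos h] using hvm _ (by omega)
    · simpa only [u, if_neg h] using hwm i
  have hη : gradedProd (tailSeq u) m = gradedProd e m := by
    rw [← he.gradedProd_unitriangular hv]
    refine gradedProd_congr fun i hi => ?_
    simp [tailSeq, hi, u]
  have hηu : ∀ i, gradedProd e m * u i = u i * gradedProd e m := fun i => by
    have := he.gradedProd_mul_add_of_mem (hum i)
    rw [hm.neg_one_pow] at this
    rw [← sub_eq_zero, ← this]; noncomm_ring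
  have hηE : e m * gradedProd e m = -(gradedProd e m * e m) := by
    rw [he.mul_gradedProd le_rfl, hm.neg_one_pow, neg_one_mul]
  have hEE : e m * e m = -1 := by rw [he.sq, hm.neg_one_pow]
  have hηη := he.gradedProd_sq m
  have huE : ∀ i, u i * e m = -(e m * u i) := fun i =>
    eq_neg_of_add_eq_zero_left (he.anticomm_of_mem (hum i) le_rfl)
  have hl : ∀ x : R, (2 ^ m : R) * x = x * 2 ^ m := fun x =>
    ((Nat.cast_commute 2 x).pow_left m).eq
  have hll : (2 ^ m : R) * 2 ^ m = 4 ^ m := by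
    rw [← (Commute.refl (2 : R)).mul_pow]; norm_num
  have h2 : ∀ x : R, (2 ^ (m + 1) : K) • x = 2 * (2 ^ m * x) := fun x => by
    rw [Algebra.smul_def, ← mul_assoc, ← pow_succ', map_pow, map_ofNat]
  have h4 : algebraMap K R (-4 ^ (m + 1)) = -4 * (2 ^ m * 2 ^ m) := by
    rw [hll, neg_mul, ← pow_succ', map_neg, map_pow, map_ofNat]
  rw [← hll] at hηη
  generalize hη' : gradedProd e m = η at *
  generalize e m = E at *
  generalize (2 ^ m : R) = l at *
  have h5 : E * (l + η) = (l - η) * E := by rw [mul_add, hηE, sub_mul, hl]; abel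
  have h6 : E * (l - η) = (l + η) * E := by rw [mul_sub, hηE, add_mul, hl]; abel
  have h7 : (l + η) * (l - η) = 0 := by
    rw [add_mul, mul_sub, mul_sub, hηη, hl η]; abel
  have h8 : (l - η) * (l + η) = 0 := by
    rw [sub_mul, mul_add, mul_add, hηη, hl η]; abel
  -- With l = 2^m one has η² = l², so (l ± η)E are eigenvectors of left multiplication by η with
  -- eigenvalues ±l. Since η anticommutes with E, the commutator doubles these eigenvalues.
  refine ⟨⟨(l + η) * E, (l - η) * E, u, ?_, ?_, ?_, ?_, ?_, ?_, ?_, ?_, ?_, ?_, ?_⟩⟩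
  · calc (l + η) * E * ((l + η) * E) = (l + η) * (E * (l + η)) * E := by noncomm_ring
      _ = (l + η) * (l - η) * E * E := by rw [h5]; noncomm_ring
      _ = 0 := by rw [h7]; simp
  · calc (l - η) * E * ((l - η) * E) = (l - η) * (E * (l - η)) * E := by noncomm_ring
      _ = (l - η) * (l + η) * E * E := by rw [h6]; noncomm_ring
      _ = 0 := by rw [h8]; simp
  · calc (l + η) * E * ((l - η) * E) + (l - η) * E * ((l + η) * E)
          = (l + η) * (E * (l - η)) * E + (l - η) * (E * (l + η)) * E := by noncomm_ring
      _ = ((l + η) * (l + η) + (l - η) * (l - η)) * (E * E) := by rw [h5, h6]; noncomm_ring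
      _ = -2 * (l * l + η * η) := by rw [hEE]; noncomm_ring
      _ = _ := by rw [hηη, h4]; noncomm_ring
  · rw [hη, h2]
    calc η * ((l + η) * E) - (l + η) * E * η
        = η * ((l + η) * E) - (l + η) * (E * η) := by noncomm_ring
      _ = (η * l + l * η + 2 * (η * η)) * E := by rw [hηE]; noncomm_ring
      _ = 2 * (l * ((l + η) * E)) := by rw [hηη, ← hl]; noncomm_ring
  · rw [hη, h2]
    calc η * ((l - η) * E) - (l - η) * E * η
        = η * ((l - η) * E) - (l - η) * (E * η) := by noncomm_ring
      _ = (η * l + l * η - 2 * (η * η)) * E := by rw [hηE]; noncomm_ring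
      _ = -(2 * (l * ((l - η) * E))) := by rw [hηη, ← hl]; noncomm_ring
  · intro i
    calc (l + η) * E * u i + u i * ((l + η) * E)
        = (l + η) * (E * u i) + ((u i * l) + (u i * η)) * E := by noncomm_ring
      _ = (l + η) * (E * u i + u i * E) := by rw [← hl, ← hηu]; noncomm_ring
      _ = 0 := by rw [huE]; simp
  · intro i
    calc (l - η) * E * u i + u i * ((l - η) * E)
        = (l - η) * (E * u i) + ((u i * l) - (u i * η)) * E := by noncomm_ring
      _ = (l - η) * (E * u i + u i * E) := by rw [← hl, ← hηu]; noncomm_ring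
      _ = 0 := by rw [huE]; simp
  · intro i
    rw [hη, hηu]
  · exact fun i => he.exists_sq (hum i)
  · intro i j hij hj
    have hj' : u j = v (j - 2) := if_pos hj
    have hjm : (j : ℕ) - 2 < m := by omega
    have ej : (⟨(j : ℕ) - 2 + 2, by omega⟩ : Fin (m + 2)) = j := by ext; simp; omega
    by_cases hi : 2 ≤ (i : ℕ)
    · have hi' : u i = v (i - 2) := if_pos hi
      have him : (i : ℕ) - 2 < m := by omega
      have ei : (⟨(i : ℕ) - 2 + 2, by omega⟩ : Fin (m + 2)) = i := by ext; simp; omega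
      rw [hi', hj', hvv _ _ (by have : (i : ℕ) < j := hij; omega) hjm, dif_pos ⟨him, hjm⟩, ei, ej]
    · have hi' : u i = w i := if_neg hi
      rw [hi', hj', hw i _ hjm, dif_pos hjm, ej]
  · exact he.exists_anticommutator (hum 0) (hum 1)

end CliffordPoint

/-! ### The transvections and their action on points. -/

section Automorphisms

open Polynomial

theorem Polynomial.commute_aeval {k A : Type*} [CommRing k] [Ring A] [Algebra k A] {z w : A}
    (h : Commute z w) (f : k[X]) : Commute (aeval z f) w := by
  induction f using Polynomial.induction_on' with
  | add p q hp hq => rw [map_add]; exact hp.add_left hq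
  | monomial n c =>
    rw [aeval_monomial]
    exact Commute.mul_left (Algebra.commutes c w) (h.pow_left n)

namespace ModifiedQuantumWeyl

variable {k : Type*} [CommRing k]

section Basic

variable {n : ℕ} (a : Fin n → Fin n → k)

/-- The generators `xᵢ`. -/
noncomputable def gen (i : Fin n) : ModifiedQuantumWeyl a :=
  RingQuot.mkAlgHom k (ModifiedQuantumWeylRel a) (FreeAlgebra.ι k i)

theorem gen_mul_add {i j : Fin n} (h : i < j) :
    gen a i * gen a j + gen a j * gen a i = algebraMap k _ (a i j) := by
  have := RingQuot.mkAlgHom_rel k (ModifiedQuantumWeylRel.anticomm (a := a) i j h)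
  rw [map_add, map_mul, map_mul, AlgHom.commutes] at this
  exact this

theorem gen_mul_add_mem_center {i j : Fin n} (h : i ≠ j) :
    gen a i * gen a j + gen a j * gen a i ∈ Subring.center (ModifiedQuantumWeyl a) := by
  rcases lt_or_gt_of_ne h with h | h
  · rw [gen_mul_add a h]
    exact Subring.mem_center_iff.2 fun g => (Algebra.commutes _ g).symm
  · rw [add_comm, gen_mul_add a h]
    exact Subring.mem_center_iff.2 fun g => (Algebra.commutes _ g).symm

theorem commute_gen_sq (i j : Fin n) : Commute (gen a j * gen a j) (gen a i) := by
  by_cases h : i = j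
  · subst h
    exact (Commute.refl _).mul_left (Commute.refl _)
  · exact sq_commute_of_anticomm_central (gen_mul_add_mem_center a h)

variable {a}

variable {B : Type*} [Ring B] [Algebra k B]

theorem hom_ext {f g : ModifiedQuantumWeyl a →ₐ[k] B} (h : ∀ i, f (gen a i) = g (gen a i)) :
    f = g := by
  refine RingQuot.ringQuot_ext' (S := k) (A := FreeAlgebra k (Fin n)) f g ?_
  refine FreeAlgebra.hom_ext (funext fun i => ?_)
  exact h i

/-- The universal property. -/
noncomputable def lift (y : Fin n → B)
    (hy : ∀ i j, i < j → y i * y j + y j * y i = algebraMap k B (a i j)) :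
    ModifiedQuantumWeyl a →ₐ[k] B :=
  RingQuot.liftAlgHom k ⟨FreeAlgebra.lift k y, by
    rintro _ _ ⟨i, j, hij⟩
    simp [hy i j hij]⟩

theorem lift_gen (y : Fin n → B)
    (hy : ∀ i j, i < j → y i * y j + y j * y i = algebraMap k B (a i j)) (i : Fin n) :
    lift y hy (gen a i) = y i := by
  refine (RingQuot.liftAlgHom_mkAlgHom_apply k (FreeAlgebra.lift k y) _ _).trans ?_
  simp

end Basic

section Transvection

variable {m : ℕ}

/-- The ordered pairs `(0, 1)` and `(1, 0)`. -/
def IsPair (i j : Fin (m + 2)) : Prop := (i : ℕ) < 2 ∧ (j : ℕ) < 2 ∧ i ≠ j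

variable (a : Fin (m + 2) → Fin (m + 2) → k)

/-- The graded product of the generators of index at least two. -/
noncomputable def tailProd : ModifiedQuantumWeyl a := gradedProd (tailSeq (gen a)) m

variable {a}

theorem tailProd_commute (hm : Odd m) {q : Fin (m + 2)} (hq : 2 ≤ (q : ℕ)) :
    Commute (tailProd a) (gen a q) := by
  have h := gradedProd_commute (y := tailSeq (gen a)) hm (fun i hi j hj hij => by
    rw [tailSeq_of_lt _ hi, tailSeq_of_lt _ hj]
    exact gen_mul_add_mem_center a (by simpa using hij)) (i := (q : ℕ) - 2) (by omega)
  rw [tailSeq_of_lt _ (by omega)] at h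
  have e : (⟨(q : ℕ) - 2 + 2, by omega⟩ : Fin (m + 2)) = q := Fin.ext (by simp; omega)
  rwa [e] at h

/-- The term `f(xⱼ²) [ζ, xⱼ]` added to `xᵢ` by a transvection. -/
noncomputable def increment (a : Fin (m + 2) → Fin (m + 2) → k) (j : Fin (m + 2)) (f : k[X]) :
    ModifiedQuantumWeyl a :=
  aeval (gen a j * gen a j) f * (tailProd a * gen a j - gen a j * tailProd a)

theorem increment_add (j : Fin (m + 2)) (f g : k[X]) :
    increment a j (f + g) = increment a j f + increment a j g := by
  simp [increment, add_mul]

/-- For `q = j` the anticommutator of [ζ, xⱼ] with `gen a q` is [ζ, xⱼ²] = 0. For q ≥ 2, ζ commutes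
with `gen a q` and the anticommutator is [ζ, xⱼx_q + x_qxⱼ] = 0. The factor f(xⱼ²) is central. -/
theorem increment_anticomm (hm : Odd m) {i j : Fin (m + 2)} (hij : IsPair i j) (f : k[X])
    {q : Fin (m + 2)} (hq : q ≠ i) :
    increment a j f * gen a q + gen a q * increment a j f = 0 := by
  have hF : Commute (aeval (gen a j * gen a j) f) (gen a q) :=
    Polynomial.commute_aeval (commute_gen_sq a q j) f
  suffices h : (tailProd a * gen a j - gen a j * tailProd a) * gen a q
      + gen a q * (tailProd a * gen a j - gen a j * tailProd a) = 0 by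
    rw [increment, ← mul_assoc (gen a q), ← hF.eq, mul_assoc, mul_assoc, ← mul_add, h, mul_zero]
  obtain ⟨hi, hj, hne⟩ := hij
  by_cases hqj : q = j
  · subst hqj
    have h := commute_gradedProd (y := tailSeq (gen a)) (l := m) (z := gen a q * gen a q)
      fun i hi => by
        rw [tailSeq_of_lt _ hi]
        exact commute_gen_sq a _ _
    change Commute _ (tailProd a) at h
    have e : (tailProd a * gen a q - gen a q * tailProd a) * gen a q
      + gen a q * (tailProd a * gen a q - gen a q * tailProd a) =
      tailProd a * (gen a q * gen a q) - gen a q * gen a q * tailProd a := by noncomm_ring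
    rw [e, h.eq, sub_self]
  · have hq2 : 2 ≤ (q : ℕ) := by
      by_contra h
      have h1 : (q : ℕ) ≠ i := fun h => hq (Fin.ext h)
      have h2 : (q : ℕ) ≠ j := fun h => hqj (Fin.ext h)
      have h3 : (i : ℕ) ≠ j := fun h => hne (Fin.ext h)
      omega
    have h := (tailProd_commute (a := a) hm hq2).eq
    have hc := Subring.mem_center_iff.1 (gen_mul_add_mem_center a hqj) (tailProd a)
    calc _ = tailProd a * (gen a j * gen a q) - gen a j * (tailProd a * gen a q)
          + (gen a q * tailProd a) * gen a j - gen a q * gen a j * tailProd a := by noncomm_ring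
      _ = tailProd a * (gen a j * gen a q) - gen a j * (gen a q * tailProd a)
          + (tailProd a * gen a q) * gen a j - gen a q * gen a j * tailProd a := by rw [h]
      _ = tailProd a * (gen a q * gen a j + gen a j * gen a q)
          - (gen a q * gen a j + gen a j * gen a q) * tailProd a := by
        noncomm_ring
      _ = 0 := by rw [hc, sub_self]

/-- The endomorphism `xᵢ ↦ xᵢ + f(xⱼ²) [ζ, xⱼ]` fixing the other generators. -/
noncomputable def transvectionHom (a : Fin (m + 2) → Fin (m + 2) → k) (hm : Odd m)
    {i j : Fin (m + 2)} (hij : IsPair i j) (f : k[X]) :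
    ModifiedQuantumWeyl a →ₐ[k] ModifiedQuantumWeyl a :=
  lift (Function.update (gen a) i (gen a i + increment a j f)) fun p q hpq => by
    by_cases hp : p = i
    · subst hp
      rw [Function.update_self, Function.update_of_ne hpq.ne', ← gen_mul_add a hpq, add_mul,
        mul_add, add_add_add_comm, increment_anticomm hm hij f hpq.ne', add_zero]
    · by_cases hq : q = i
      · subst hq
        rw [Function.update_self, Function.update_of_ne hp, ← gen_mul_add a hpq, add_mul,
          mul_add, add_add_add_comm, add_comm (gen a p * increment a j f),
          increment_anticomm hm hij f hp, add_zero]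
      · rw [Function.update_of_ne hp, Function.update_of_ne hq, gen_mul_add a hpq]

theorem transvectionHom_self (hm : Odd m) {i j : Fin (m + 2)} (hij : IsPair i j) (f : k[X]) :
    transvectionHom a hm hij f (gen a i) = gen a i + increment a j f := by
  rw [transvectionHom, lift_gen, Function.update_self]

theorem transvectionHom_of_ne (hm : Odd m) {i j q : Fin (m + 2)} (hij : IsPair i j) (f : k[X])
    (hq : q ≠ i) : transvectionHom a hm hij f (gen a q) = gen a q := by
  rw [transvectionHom, lift_gen, Function.update_of_ne hq]

/-- The increment involves only `gen a j` and tail generators, all fixed. This makes transvections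
additive in `f`, hence invertible. -/
theorem transvectionHom_increment (hm : Odd m) {i j : Fin (m + 2)} (hij : IsPair i j)
    (f g : k[X]) : transvectionHom a hm hij f (increment a j g) = increment a j g := by
  have h1 : transvectionHom a hm hij f (gen a j) = gen a j :=
    transvectionHom_of_ne hm hij f hij.2.2.symm
  have h2 : transvectionHom a hm hij f (tailProd a) = tailProd a := by
    rw [tailProd, map_gradedProd]
    refine gradedProd_congr fun l hl => ?_
    rw [tailSeq_of_lt _ hl]
    refine transvectionHom_of_ne hm hij f fun h => ?_
    have := hij.1
    rw [← h] at this
    simp at this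
  rw [increment, map_mul, map_sub, map_mul, map_mul, h1, h2, ← aeval_algHom_apply, map_mul, h1]

theorem transvectionHom_comp (hm : Odd m) {i j : Fin (m + 2)} (hij : IsPair i j) (f g : k[X]) :
    (transvectionHom a hm hij f).comp (transvectionHom a hm hij g) =
      transvectionHom a hm hij (f + g) := by
  refine hom_ext fun q => ?_
  by_cases hq : q = i
  · subst hq
    rw [AlgHom.comp_apply, transvectionHom_self, transvectionHom_self, map_add,
      transvectionHom_increment, transvectionHom_self, increment_add, add_assoc]
  · rw [AlgHom.comp_apply, transvectionHom_of_ne hm hij _ hq, transvectionHom_of_ne hm hij _ hq,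
      transvectionHom_of_ne hm hij _ hq]

theorem transvectionHom_zero (hm : Odd m) {i j : Fin (m + 2)} (hij : IsPair i j) :
    transvectionHom a hm hij 0 = AlgHom.id k _ := by
  refine hom_ext fun q => ?_
  by_cases hq : q = i
  · subst hq
    simp [transvectionHom_self, increment]
  · rw [transvectionHom_of_ne hm hij _ hq, AlgHom.id_apply]

/-- The automorphism `xᵢ ↦ xᵢ + f(xⱼ²) [ζ, xⱼ]` fixing the other generators. -/
noncomputable def transvection (a : Fin (m + 2) → Fin (m + 2) → k) (hm : Odd m)
    {i j : Fin (m + 2)} (hij : IsPair i j) (f : k[X]) :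
    ModifiedQuantumWeyl a ≃ₐ[k] ModifiedQuantumWeyl a :=
  AlgEquiv.ofAlgHom (transvectionHom a hm hij f) (transvectionHom a hm hij (-f))
    (by rw [transvectionHom_comp, add_neg_cancel, transvectionHom_zero])
    (by rw [transvectionHom_comp, neg_add_cancel, transvectionHom_zero])

end Transvection

end ModifiedQuantumWeyl

/-- Automorphisms of an algebra act on its points. -/
@[reducible] def AlgEquiv.pointAction (k A R : Type*) [CommRing k] [Ring A] [Ring R] [Algebra k A]
    [Algebra k R] : MulAction (A ≃ₐ[k] A) (A →ₐ[k] R) where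
  smul σ h := h.comp (σ.symm : A →ₐ[k] A)
  one_smul _ := rfl
  mul_smul _ _ _ := rfl

end Automorphisms

/-! ### Coordinates of points, and growth of their degrees. -/

section States

open Polynomial

namespace CliffordPoint

variable {K R : Type*} [CommRing K] [Ring R] [Algebra K R] {m : ℕ}
  {a : Fin (m + 2) → Fin (m + 2) → K} (P : CliffordPoint K R a)

/-- The vector `u l + (α, β)`, where `(α, β)` are coordinates in the hyperbolic plane. -/
def vec (α β : K) (l : Fin (m + 2)) : R := α • P.gp + β • P.gm + P.u l

theorem vec_anticomm (α β α' β' : K) (i j : Fin (m + 2)) :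
    P.vec α β i * P.vec α' β' j + P.vec α' β' j * P.vec α β i =
      algebraMap K R (-4 ^ (m + 1) * (α * β' + β * α')) + (P.u i * P.u j + P.u j * P.u i) := by
  have h : algebraMap K R (-4 ^ (m + 1) * (α * β' + β * α')) =
      (α * β' + β * α') • (P.gp * P.gm + P.gm * P.gp) := by
    rw [P.gp_gm, Algebra.smul_def, mul_comm, map_mul]
  rw [h]
  have h1 := P.gp_sq
  have h2 := P.gm_sq
  have h3 := P.gp_u i
  have h4 := P.gp_u j
  have h5 := P.gm_u i
  have h6 := P.gm_u j
  simp only [vec, add_mul, mul_add, smul_mul_assoc, mul_smul_comm, h1, h2]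
  linear_combination (norm := module) α' • h3 + α • h4 + β' • h5 + β • h6

theorem vec_sq (α β d : K) (i : Fin (m + 2)) (hd : P.u i * P.u i = algebraMap K R d) :
    P.vec α β i * P.vec α β i = algebraMap K R (-4 ^ (m + 1) * (α * β) + d) := by
  have h : algebraMap K R (-4 ^ (m + 1) * (α * β) + d) =
      (α * β) • (P.gp * P.gm + P.gm * P.gp) + P.u i * P.u i := by
    rw [P.gp_gm, Algebra.smul_def, map_add, hd, mul_comm, map_mul]
  rw [h]
  have h1 := P.gp_sq
  have h2 := P.gm_sq
  have h3 := P.gp_u i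
  have h5 := P.gm_u i
  simp only [vec, add_mul, mul_add, smul_mul_assoc, mul_smul_comm, h1, h2]
  linear_combination (norm := module) α • h3 + β • h5

theorem vec_comm (α β : K) (i : Fin (m + 2)) :
    gradedProd (tailSeq P.u) m * P.vec α β i - P.vec α β i * gradedProd (tailSeq P.u) m =
      (2 ^ (m + 1) * α) • P.gp - (2 ^ (m + 1) * β) • P.gm := by
  have h1 := P.comm_gp
  have h2 := P.comm_gm
  have h3 := P.comm_u i
  simp only [vec, add_mul, mul_add, smul_mul_assoc, mul_smul_comm, h3]
  linear_combination (norm := module) α • h1 + β • h2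

/-- Anticommutators with vectors whose hyperbolic part is `gp` or `gm` read off the coordinates, up
to the unit -4^(m+1). -/
theorem vec_injective (hK : Function.Injective (algebraMap K R))
    (h4 : IsUnit (-4 ^ (m + 1) : K)) {α β α' β' : K} {i : Fin (m + 2)}
    (h : P.vec α β i = P.vec α' β' i) : α = α' ∧ β = β' := by
  have e : ∀ γ δ : K, γ * β + δ * α = γ * β' + δ * α' := fun γ δ => by
    have h1 := P.vec_anticomm γ δ α β i i
    rw [h, P.vec_anticomm γ δ α' β' i i] at h1
    exact (h4.mul_left_cancel (hK (add_right_cancel h1))).symm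
  exact ⟨by simpa using e 0 1, by simpa using e 1 0⟩

end CliffordPoint

namespace ModifiedQuantumWeyl

variable {k K R : Type*} [CommRing k] [CommRing K] [Ring R] [Algebra k K] [Algebra K R]
  [Algebra k R] [IsScalarTower k K R] {m : ℕ} {a : Fin (m + 2) → Fin (m + 2) → k}
  (P : CliffordPoint K R fun i j => algebraMap k K (a i j))

/-- A point of the algebra given by coordinates `α`, `β` of its first two generators. -/
structure IsState (h : ModifiedQuantumWeyl a →ₐ[k] R) (α β : Fin (m + 2) → K) : Prop where
  apply_gen : ∀ l, h (gen a l) = P.vec (α l) (β l) l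
  tail_left : ∀ l : Fin (m + 2), 2 ≤ (l : ℕ) → α l = 0
  tail_right : ∀ l : Fin (m + 2), 2 ≤ (l : ℕ) → β l = 0

variable {P}

/-- The tail has no hyperbolic part, so ζ goes to the graded product of the `u i`, whose commutator
is diagonal on `gp`, `gm` and kills `u j`. Since xⱼ² goes to a scalar, f(xⱼ²) goes to the scalar
`q`. -/
theorem IsState.comp_transvectionHom {h : ModifiedQuantumWeyl a →ₐ[k] R}
    {α β : Fin (m + 2) → K} (H : IsState P h α β) (hm : Odd m) {i j : Fin (m + 2)}
    (hij : IsPair i j) (f : k[X]) {d : K} (hd : P.u j * P.u j = algebraMap K R d) {q : K}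
    (hq : q = aeval (-4 ^ (m + 1) * (α j * β j) + d) f) :
    IsState P (h.comp (transvectionHom a hm hij f))
      (Function.update α i (α i + q * (2 ^ (m + 1) * α j)))
      (Function.update β i (β i - q * (2 ^ (m + 1) * β j))) := by
  have hi : ∀ l : Fin (m + 2), 2 ≤ (l : ℕ) → l ≠ i := fun l hl h => by
    have := hij.1
    rw [← h] at this
    omega
  refine ⟨fun l => ?_, fun l hl => ?_, fun l hl => ?_⟩
  · by_cases hl : l = i
    · subst hl
      have ht : h (tailProd a) = gradedProd (tailSeq P.u) m := by
        rw [tailProd, map_gradedProd]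
        refine gradedProd_congr fun l hl => ?_
        rw [tailSeq_of_lt _ hl, tailSeq_of_lt _ hl, H.apply_gen,
          H.tail_left _ (by simp), H.tail_right _ (by simp)]
        simp [CliffordPoint.vec]
      rw [AlgHom.comp_apply, transvectionHom_self, map_add, increment, map_mul,
        ← aeval_algHom_apply, map_mul, map_sub, map_mul, map_mul, ht, H.apply_gen, H.apply_gen,
        P.vec_sq _ _ d _ hd, aeval_algebraMap_apply, ← hq, P.vec_comm, ← Algebra.smul_def,
        Function.update_self, Function.update_self]
      simp only [CliffordPoint.vec]
      module
    · rw [AlgHom.comp_apply, transvectionHom_of_ne hm hij f hl, Function.update_of_ne hl,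
        Function.update_of_ne hl, H.apply_gen]
  · rw [Function.update_of_ne (hi l hl), H.tail_left l hl]
  · rw [Function.update_of_ne (hi l hl), H.tail_right l hl]

/-- All relations except that of x₀ and x₁ hold by the choice of the `u i`; that one becomes the
single equation `h` on the coordinates. -/
theorem exists_isState {α β : Fin (m + 2) → K} (hα : ∀ l : Fin (m + 2), 2 ≤ (l : ℕ) → α l = 0)
    (hβ : ∀ l : Fin (m + 2), 2 ≤ (l : ℕ) → β l = 0) {c : K}
    (hc : P.u 0 * P.u 1 + P.u 1 * P.u 0 = algebraMap K R c)
    (h : -4 ^ (m + 1) * (α 0 * β 1 + β 0 * α 1) + c = algebraMap k K (a 0 1)) :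
    ∃ h, IsState P h α β := by
  refine ⟨lift (fun l => P.vec (α l) (β l) l) fun i j hij => ?_, fun l => lift_gen _ _ l, hα, hβ⟩
  rw [P.vec_anticomm, IsScalarTower.algebraMap_apply k K R]
  by_cases hj : 2 ≤ (j : ℕ)
  · rw [hα j hj, hβ j hj, P.u_u i j hij hj]
    simp
  · have hij' : (i : ℕ) < j := hij
    obtain rfl : i = 0 := Fin.ext (by rw [Fin.val_zero]; omega)
    obtain rfl : j = 1 := Fin.ext (by rw [Fin.val_one]; rw [Fin.val_zero] at hij'; omega)
    rw [hc, ← map_add, h]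

section Degree

variable {F : Type*} [Field F] [Algebra k F] {R : Type*} [Ring R] [Algebra F[X] R] [Algebra k R]
  (P : CliffordPoint F[X] R fun i j => algebraMap k F[X] (a i j))

/-- The points whose `i`-th vector has coordinates of degree at least (with `s = 0`) or greater
than (with `s = 1`) those of the `j`-th vector. -/
def degreeRegion (N s : ℕ) (i j : Fin (m + 2)) : Set (ModifiedQuantumWeyl a →ₐ[k] R) :=
  {h | ∃ α β, IsState P h α β ∧ N ≤ (α j).natDegree ∧ N ≤ (β j).natDegree ∧
    (α j).natDegree + s ≤ (α i).natDegree ∧ (β j).natDegree + s ≤ (β i).natDegree}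

variable {P}

theorem degreeRegion_mono {N : ℕ} {i j : Fin (m + 2)} :
    degreeRegion P N 1 i j ⊆ degreeRegion P N 0 i j := by
  rintro h ⟨α, β, H, h1, h2, h3, h4⟩
  exact ⟨α, β, H, h1, h2, by omega, by omega⟩

theorem isUnit_two_polynomial (h2 : (2 : F) ≠ 0) : IsUnit (2 : F[X]) := by
  rw [← C_ofNat]
  exact isUnit_C.2 (isUnit_iff_ne_zero.2 h2)

theorem isUnit_neg_four_pow (h2 : (2 : F) ≠ 0) (l : ℕ) : IsUnit (-4 ^ l : F[X]) := by
  have u2 := isUnit_two_polynomial h2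
  have : (4 : F[X]) = 2 * 2 := by norm_num
  rw [this]
  exact ((u2.mul u2).pow _).neg

theorem natDegree_aeval_polynomial [FaithfulSMul k F] (f : k[X]) (r : F[X]) :
    (aeval r f).natDegree = f.natDegree * r.natDegree := by
  have : aeval r f = (f.map (algebraMap k F)).comp r := by
    rw [comp, eval₂_map, aeval_def]; rfl
  rw [this, natDegree_comp, natDegree_map_eq_of_injective (FaithfulSMul.algebraMap_injective k F)]

theorem natDegree_lt_of_add_mul {x y p q μ : F[X]} (hμ : IsUnit μ) (hq : 0 < q.natDegree)
    (hy : 0 < y.natDegree) (hxy : x.natDegree ≤ y.natDegree) (hp : p = x + q * (μ * y)) :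
    y.natDegree < p.natDegree := by
  have h0 : (q * (μ * y)).natDegree = q.natDegree + y.natDegree := by
    have hq0 : q ≠ 0 := ne_zero_of_natDegree_gt hq
    have hy0 : y ≠ 0 := ne_zero_of_natDegree_gt hy
    rw [natDegree_mul hq0 (mul_ne_zero hμ.ne_zero hy0), natDegree_mul hμ.ne_zero hy0,
      natDegree_eq_zero_of_isUnit hμ, zero_add]
  rw [hp, natDegree_add_eq_right_of_natDegree_lt (by omega)]
  omega

theorem comp_transvectionHom_mem [FaithfulSMul k F] [IsScalarTower k F[X] R] (h2 : (2 : F) ≠ 0) (hm : Odd m) {N : ℕ} {i j : Fin (m + 2)}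
    (hij : IsPair i j) {d : F[X]} (hd : P.u j * P.u j = algebraMap F[X] R d)
    (hN : d.natDegree < N) {f : k[X]} (hf : 0 < f.natDegree)
    {h : ModifiedQuantumWeyl a →ₐ[k] R} (hh : h ∈ degreeRegion P N 0 j i) :
    h.comp (transvectionHom a hm hij f) ∈ degreeRegion P N 1 i j := by
  obtain ⟨α, β, H, hα, hβ, hα', hβ'⟩ := hh
  have u2 := isUnit_two_polynomial h2
  have u4 := isUnit_neg_four_pow h2 (m + 1)
  have hαj : α j ≠ 0 := ne_zero_of_natDegree_gt (by omega : 0 < (α j).natDegree)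
  have hβj : β j ≠ 0 := ne_zero_of_natDegree_gt (by omega : 0 < (β j).natDegree)
  have hr : 0 < (-4 ^ (m + 1) * (α j * β j) + d).natDegree := by
    have h1 : (-4 ^ (m + 1) * (α j * β j)).natDegree = (α j).natDegree + (β j).natDegree := by
      rw [natDegree_mul u4.ne_zero (mul_ne_zero hαj hβj), natDegree_eq_zero_of_isUnit u4, zero_add,
        natDegree_mul hαj hβj]
    rw [natDegree_add_eq_left_of_natDegree_lt (by omega)]
    omega
  obtain ⟨q, hq⟩ : ∃ q, q = aeval (-4 ^ (m + 1) * (α j * β j) + d) f := ⟨_, rfl⟩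
  have hq0 : 0 < q.natDegree := by
    rw [hq, natDegree_aeval_polynomial]
    exact Nat.mul_pos hf hr
  have H' := H.comp_transvectionHom hm hij f hd hq
  refine ⟨_, _, H', ?_⟩
  rw [Function.update_of_ne hij.2.2.symm, Function.update_of_ne hij.2.2.symm,
    Function.update_self, Function.update_self]
  refine ⟨by omega, by omega, ?_, ?_⟩
  · exact natDegree_lt_of_add_mul (u2.pow (m + 1)) hq0 (by omega) (by omega) rfl
  · refine natDegree_lt_of_add_mul (u2.pow (m + 1)).neg hq0 (by omega) (by omega) ?_ (x := β i)
    ring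

/-- Membership only asserts that some coordinates exist, so uniqueness of coordinates is needed. -/
theorem not_mem_degreeRegion (hR : Function.Injective (algebraMap F[X] R)) (h2 : (2 : F) ≠ 0)
    {N : ℕ} {i j : Fin (m + 2)} {h : ModifiedQuantumWeyl a →ₐ[k] R} {α β : Fin (m + 2) → F[X]}
    (H : IsState P h α β) (hα : (α i).natDegree = (α j).natDegree) :
    h ∉ degreeRegion P N 1 i j := by
  rintro ⟨α', β', H', -, -, h3, -⟩
  have u4 := isUnit_neg_four_pow h2 (m + 1)
  have key : ∀ l, α l = α' l := fun l =>
    (P.vec_injective hR u4 (by rw [← H.apply_gen, H'.apply_gen])).1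
  rw [← key, ← key] at h3
  omega

theorem exists_balanced_state [IsScalarTower k F[X] R] (h2 : (2 : F) ≠ 0) (P : CliffordPoint F[X] R
    fun i j => algebraMap k F[X] (a i j)) (N₀ : ℕ) :
    ∃ N, N₀ < N ∧ ∃ h α β, IsState P h α β ∧ (α 0).natDegree = N ∧ (α 1).natDegree = N ∧
      (β 0).natDegree = N ∧ (β 1).natDegree = N := by
  obtain ⟨c, hc⟩ := P.u_u'
  have u4 := isUnit_neg_four_pow h2 (m + 1)
  obtain ⟨e, he⟩ := u4.dvd (a := algebraMap k F[X] (a 0 1) - c)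
  obtain ⟨N, hN⟩ : ∃ N, N = max N₀ e.natDegree + 1 := ⟨_, rfl⟩
  have hdeg : ∀ p : F[X], p.natDegree < N → (X ^ N + p).natDegree = N := fun p hp => by
    rw [natDegree_add_eq_left_of_natDegree_lt (by rwa [natDegree_X_pow]), natDegree_X_pow]
  have hdeg' : ∀ p : F[X], p.natDegree < N → (p - X ^ N).natDegree = N := fun p hp => by
    rw [natDegree_sub_eq_right_of_natDegree_lt (by rwa [natDegree_X_pow]), natDegree_X_pow]
  have h1 : (1 - e).natDegree < N := by
    have := natDegree_sub_le 1 e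
    rw [natDegree_one] at this
    omega
  -- The relation of x₀ and x₁ requires α₀β₁ + β₀α₁ = e. With these values the powers of X cancel
  -- and e remains, while all four degrees are N because N exceeds deg e.
  let α : Fin (m + 2) → F[X] := fun l => if l = 0 then X ^ N else if l = 1 then e - X ^ N else 0
  let β : Fin (m + 2) → F[X] := fun l =>
    if l = 0 then X ^ N + 1 else if l = 1 then X ^ N + (1 - e) else 0
  have hl : ∀ l : Fin (m + 2), 2 ≤ (l : ℕ) → l ≠ 0 ∧ l ≠ 1 := fun l hl =>
    ⟨fun h => by simp [h] at hl, fun h => by simp [h] at hl⟩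
  have h10 : (1 : Fin (m + 2)) ≠ 0 := by simp
  obtain ⟨h, H⟩ := exists_isState (P := P) (α := α) (β := β)
    (fun l h => by simp [α, hl l h]) (fun l h => by simp [β, hl l h]) hc (by
      simp only [α, β, if_pos, if_neg h10]
      linear_combination -he)
  refine ⟨N, by omega, h, α, β, H, ?_, ?_, ?_, ?_⟩
  · simp [α]
  · simpa only [α, if_pos, if_neg h10] using hdeg' e (by omega)
  · simpa only [β, if_pos] using hdeg 1 (by rw [natDegree_one]; omega)
  · simpa only [β, if_pos, if_neg h10] using hdeg _ h1

end Degree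

universe u in
/-- The products of transvections `x₀ ↦ x₀ + x₁^(2j+2) [ζ, x₁]` and `x₁ ↦ x₁ + x₀^(2j+2) [ζ, x₀]`
freely generate a free group. -/
theorem exists_freeGroup_nat_injective {k : Type u} [CommRing k] [IsDomain k] (h2 : (2 : k) ≠ 0)
    {m : ℕ} (hm : Odd m) (a : Fin (m + 2) → Fin (m + 2) → k) :
    ∃ f : FreeGroup ℕ →* (ModifiedQuantumWeyl a ≃ₐ[k] ModifiedQuantumWeyl a),
      Function.Injective f := by
  -- Over F[X] the element 2 is a unit, and the degree of a product of nonzero polynomials is the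
  -- sum of the degrees.
  let F := FractionRing k
  have hF : (2 : F) ≠ 0 := by
    have := (map_ne_zero_iff (algebraMap k F) (FaithfulSMul.algebraMap_injective k F)).2 h2
    rwa [map_ofNat] at this
  have u2 := isUnit_two_polynomial hF
  let : Invertible (2 : F[X]) := u2.invertible
  obtain ⟨R, _, _, e, he, hR⟩ := exists_isCliffordSequence F[X]
  obtain ⟨P⟩ := he.nonempty_cliffordPoint hm fun i j => algebraMap k F[X] (a i j)
  let : Algebra k R := Algebra.compHom R (algebraMap k F[X])
  have : IsScalarTower k F[X] R := IsScalarTower.of_algebraMap_eq fun _ => rfl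
  let := AlgEquiv.pointAction k (ModifiedQuantumWeyl a) R
  obtain ⟨d₀, hd₀⟩ := P.u_sq 0
  obtain ⟨d₁, hd₁⟩ := P.u_sq 1
  obtain ⟨N, hN, s, α, β, H, hα₀, hα₁, hβ₀, hβ₁⟩ :=
    exists_balanced_state hF P (max d₀.natDegree d₁.natDegree)
  have p₀ : IsPair (0 : Fin (m + 2)) 1 := ⟨by simp, by simp, by simp⟩
  have p₁ : IsPair (1 : Fin (m + 2)) 0 := ⟨by simp, by simp, by simp⟩
  -- Quotients of transvections in one direction correspond to differences of the polynomials.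
  -- Distinct powers keep these nonconstant over any domain, finite fields included.
  have hne : ∀ i j : ℕ, i ≠ j → 0 < (X ^ (i + 1) - X ^ (j + 1) : k[X]).natDegree := by
    intro i j hij
    rcases lt_or_gt_of_ne hij with h | h
    · rw [natDegree_sub_eq_right_of_natDegree_lt (by simpa using h)]; simp
    · rw [natDegree_sub_eq_left_of_natDegree_lt (by simpa using h)]; simp
  -- The action precomposes with the inverse automorphism, hence the sign of `f`.
  have hsmul : ∀ {i j : Fin (m + 2)} (p : IsPair i j) (f : k[X])
      (h : ModifiedQuantumWeyl a →ₐ[k] R),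
      transvection a hm p f • h = h.comp (transvectionHom a hm p (-f)) := fun _ _ _ => rfl
  have hinv : ∀ {i j : Fin (m + 2)} (p : IsPair i j) (f : k[X])
      (h : ModifiedQuantumWeyl a →ₐ[k] R),
      (transvection a hm p f)⁻¹ • h = h.comp (transvectionHom a hm p f) := fun _ _ _ => rfl
  have m₀ : ∀ {f : k[X]}, 0 < f.natDegree → ∀ x ∈ degreeRegion P N 0 1 0,
      x.comp (transvectionHom a hm p₀ f) ∈ degreeRegion P N 1 0 1 := fun hf x hx =>
    comp_transvectionHom_mem hF hm p₀ hd₁ (by omega) hf hx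
  have m₁ : ∀ {f : k[X]}, 0 < f.natDegree → ∀ x ∈ degreeRegion P N 0 0 1,
      x.comp (transvectionHom a hm p₁ f) ∈ degreeRegion P N 1 1 0 := fun hf x hx =>
    comp_transvectionHom_mem hF hm p₁ hd₀ (by omega) hf hx
  refine ⟨_, FreeGroup.lift_mul_injective
    (fun l : ℕ => transvection a hm p₀ (X ^ (l + 1)))
    (fun l : ℕ => transvection a hm p₁ (X ^ (l + 1)))
    (degreeRegion P N 1 0 1) (degreeRegion P N 0 0 1)
    (degreeRegion P N 1 1 0) (degreeRegion P N 0 1 0)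
    degreeRegion_mono degreeRegion_mono s
    ⟨α, β, H, by omega, by omega, by omega, by omega⟩
    ⟨α, β, H, by omega, by omega, by omega, by omega⟩
    (not_mem_degreeRegion hR hF H (by omega)) (not_mem_degreeRegion hR hF H (by omega))
    (fun l x hx => ?_) (fun l x hx => ?_) (fun l l' hl x hx => ?_)
    (fun l x hx => ?_) (fun l x hx => ?_) (fun l l' hl x hx => ?_)⟩
  · rw [hsmul]
    exact m₀ (by simp) x hx
  · rw [hinv]
    exact m₀ (by simp) x hx
  · rw [hinv, hsmul, AlgHom.comp_assoc, transvectionHom_comp, neg_add_eq_sub]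
    exact m₀ (hne l l' hl) x hx
  · rw [hsmul]
    exact m₁ (by simp) x hx
  · rw [hinv]
    exact m₁ (by simp) x hx
  · rw [hsmul, hinv, AlgHom.comp_assoc, transvectionHom_comp, ← sub_eq_add_neg]
    exact m₁ (hne l' l hl.symm) x hx

end ModifiedQuantumWeyl

end States

theorem theorem2 {k : Type*} [CommRing k] [IsDomain k] (n : ℕ) (hn : 3 ≤ n) (hodd : Odd n)
    (hchar : ¬ ringChar k ∣ Nat.factorial (n - 1)) (a : Fin n → Fin n → k) :
    (∃ f : FreeGroup (Fin 2) →* (ModifiedQuantumWeyl a ≃ₐ[k] ModifiedQuantumWeyl a),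
      Function.Injective f) ∧
    (∃ f : FreeGroup ℕ →* (ModifiedQuantumWeyl a ≃ₐ[k] ModifiedQuantumWeyl a),
      Function.Injective f) := by
  -- As n - 1 ≥ 2, the factorial is divisible by 2, so the characteristic cannot divide 2.
  have h2 : (2 : k) ≠ 0 := fun h =>
    hchar (((ringChar.spec k 2).1 (by exact_mod_cast h)).trans
      (Nat.dvd_factorial (by omega) (by omega)))
  obtain ⟨m, rfl⟩ : ∃ m, n = m + 2 := ⟨n - 2, by omega⟩
  have hm : Odd m := by
    rw [Nat.odd_iff] at hodd ⊢
    omega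
  obtain ⟨f, hf⟩ := ModifiedQuantumWeyl.exists_freeGroup_nat_injective h2 hm a
  exact ⟨⟨f.comp (FreeGroup.map fun i : Fin 2 => (i : ℕ)),
    hf.comp (FreeGroup.map_injective Fin.val_injective)⟩, f, hf⟩
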